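/- Let $R$ be a henselian Gorenstein (commutative noetherian) local ring, let $\operatorname{mod}R$ be the category of finitely generated $R$-modules, and suppose that $R$ satisfies the Auslander–Reiten condition: (ARC) every $M\in\operatorname{mod}R$ with $\operatorname{Ext}_R^{i}(M,M\oplus R)=0$ for all $i>0$ is free. Let $\mathscr X$ be a resolving subcategory of $\operatorname{mod}R$, i.e. a strictly full subcategory that contains the projective modules and is closed under direct summands, extensions and kernels of epimorphisms. Write $\mathscr X^{\perp}$ for the subcategory of all $M\in\operatorname{mod}R$ with $\operatorname{Ext}_R^{i}(X,M)=0$ for all $i>0$ and all $X\in\mathscr X$. Suppose that every module in $\mathscr X$ is maximal Cohen–Macaulay (where the zero module counts as maximal Cohen–Macaulay) and that $\mathscr X$ satisfies Mifune's condition: (A) for every $X\in\mathscr X$ there is an exact sequence $0\to X\to Y\to X'\to 0$ in $\operatorname{mod}R$ with $X'\in\mathscr X$ and $Y\in\mathscr X\cap\mathscr X^{\perp}$. Then $\mathscr X$ is coherent: for $M\in\operatorname{mod}R$, the functor $\operatorname{Hom}_R(-,M)|_{\mathscr X}$ is finitely presented, i.e. there is an exact sequence $\operatorname{Hom}_R(-,X_1)|_{\mathscr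 X}\to\operatorname{Hom}_R(-,X_0)|_{\mathscr X}\to\operatorname{Hom}_R(-,M)|_{\mathscr X}\to 0$ of functors on $\mathscr X$ with $X_0,X_1\in\mathscr X$, if and only if $M$ admits a right $\mathscr X$-approximation, i.e. a homomorphism $f\colon X\to M$ with $X\in\mathscr X$ through which every homomorphism from a module in $\mathscr X$ to $M$ factors. Moreover, $\mathscr X^{\perp}$ is closed under syzygies: it contains the projective modules in $\operatorname{mod}R$, and for every exact sequence $0\to N\to P\to M\to 0$ in $\operatorname{mod}R$ with $P$ projective and $M\in\mathscr X^{\perp}$ one has $N\in\mathscr X^{\perp}$. -/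

import Mathlib

open CategoryTheory CategoryTheory.Limits CategoryTheory.Abelian

universe u

namespace ResolvingSubcat

/-! ### Subcategories of an abelian category

Subcategories are strictly full, so they are given by properties of objects. -/

section Abelian

variable {𝒜 : Type*} [Category 𝒜]

/-- `f : X ⟶ M` is a right `𝒳`-approximation of `M`: `X ∈ 𝒳` and every morphism to `M` from an
object of `𝒳` factors through `f`. -/
def IsRightApproximation (𝒳 : ObjectProperty 𝒜) {X M : 𝒜} (f : X ⟶ M) : Prop :=
  𝒳 X ∧ ∀ (X' : 𝒜) (f' : X' ⟶ M), 𝒳 X' → ∃ g : X' ⟶ X, f' = g ≫ f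

/-- The subcategory `rap 𝒳` of the objects that admit a right `𝒳`-approximation. -/
def rap (𝒳 : ObjectProperty 𝒜) : ObjectProperty 𝒜 :=
  fun M => ∃ (X : 𝒜) (f : X ⟶ M), IsRightApproximation 𝒳 f

variable [Abelian 𝒜]

/-- A resolving subcategory: it contains the projective objects and is closed under direct
summands, extensions and kernels of epimorphisms. (Closure under isomorphisms follows.) -/
structure IsResolving (𝒳 : ObjectProperty 𝒜) : Prop where
  projective : ∀ P : 𝒜, Projective P → 𝒳 P
  summand : ∀ A B : 𝒜, 𝒳 (A ⊞ B) → 𝒳 A ∧ 𝒳 B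
  extension : ∀ S : ShortComplex 𝒜, S.ShortExact → 𝒳 S.X₁ → 𝒳 S.X₃ → 𝒳 S.X₂
  kernel : ∀ S : ShortComplex 𝒜, S.ShortExact → 𝒳 S.X₂ → 𝒳 S.X₃ → 𝒳 S.X₁

/-- Closed under syzygies: contains the projective objects, and every first syzygy of an object
of the subcategory (for every choice of the projective object) is in the subcategory. -/
structure IsClosedUnderSyzygies (𝒴 : ObjectProperty 𝒜) : Prop where
  projective : ∀ P : 𝒜, Projective P → 𝒴 P
  syzygy : ∀ S : ShortComplex 𝒜, S.ShortExact → Projective S.X₂ → 𝒴 S.X₃ → 𝒴 S.X₁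

end Abelian

/-! ### Finitely presented functors -/

/-- A contravariant functor `F` from a preadditive category to abelian groups is finitely
presented if there is an exact sequence `Hom(-, A₁) ⟶ Hom(-, A₀) ⟶ F ⟶ 0`. Being a cokernel of
additive functors, such an `F` is additive, and exactness is the same among additive functors as
among all functors, namely objectwise. -/
def IsFinitelyPresentedFunctor {𝒞 : Type*} [Category.{u} 𝒞] [Preadditive 𝒞]
    (F : 𝒞ᵒᵖ ⥤ AddCommGrpCat.{u}) : Prop :=
  ∃ (A₁ A₀ : 𝒞) (φ : preadditiveYoneda.obj A₁ ⟶ preadditiveYoneda.obj A₀)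
    (π : preadditiveYoneda.obj A₀ ⟶ F) (w : φ ≫ π = 0),
    (ShortComplex.mk φ π w).Exact ∧ Epi π

section FinitelyPresented

variable {𝒜 : Type*} [Category.{u} 𝒜] [Preadditive 𝒜]

/-- The functor `Hom(-, M)` restricted to the subcategory `𝒳`. -/
noncomputable abbrev restrictedHom (𝒳 : ObjectProperty 𝒜) (M : 𝒜) :
    (𝒳.FullSubcategory)ᵒᵖ ⥤ AddCommGrpCat.{u} :=
  𝒳.ι.op ⋙ preadditiveYoneda.obj M

/-- The subcategory of the objects `C` such that `Hom(-, C)|_𝒳` is finitely presented. -/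
def finPres (𝒳 : ObjectProperty 𝒜) : ObjectProperty 𝒜 :=
  fun C => IsFinitelyPresentedFunctor (restrictedHom 𝒳 C)

/-- `𝒳` is coherent if the objects `M` with `Hom(-, M)|_𝒳` finitely presented are exactly
those that admit a right `𝒳`-approximation. -/
def IsCoherent (𝒳 : ObjectProperty 𝒜) : Prop :=
  finPres 𝒳 = rap 𝒳

end FinitelyPresented

/-! ### Finitely generated modules over a noetherian (local) ring -/

section Modules

variable {R : Type u} [CommRing R]

/-- `Ext_R^{>0}(M, N) = 0`. -/
def ExtPosVanish (M N : ModuleCat.{u} R) : Prop :=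
  ∀ i : ℕ, 0 < i → Subsingleton (Ext.{u} M N i)

/-- `𝒳^⊥`: the finitely generated modules `M` with `Ext_R^{>0}(X, M) = 0` for all `X ∈ 𝒳`. -/
def perp (𝒳 : ObjectProperty (FGModuleCat.{u} R)) : ObjectProperty (FGModuleCat.{u} R) :=
  fun M => ∀ X : FGModuleCat.{u} R, 𝒳 X → ExtPosVanish X.obj M.obj

/-- Condition **(A)**: every `X ∈ 𝒳` fits in an exact sequence `0 → X → Y → X' → 0` of finitely
generated modules with `X' ∈ 𝒳` and `Y ∈ 𝒳 ∩ 𝒳^⊥`. -/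
def ConditionA [IsNoetherianRing R] (𝒳 : ObjectProperty (FGModuleCat.{u} R)) : Prop :=
  ∀ X : FGModuleCat.{u} R, 𝒳 X →
    ∃ (Y X' : FGModuleCat.{u} R) (f : X ⟶ Y) (g : Y ⟶ X') (w : f ≫ g = 0),
      (ShortComplex.mk f g w).ShortExact ∧ 𝒳 X' ∧ 𝒳 Y ∧ perp 𝒳 Y

variable (R) in
/-- The Auslander–Reiten condition **(ARC)**: every finitely generated module `M` with
`Ext_R^{>0}(M, M ⊕ R) = 0` is free. -/
def ARC : Prop :=
  ∀ M : FGModuleCat.{u} R,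
    ExtPosVanish M.obj (ModuleCat.of R (M.obj × R)) → Module.Free R M.obj

variable (R) in
/-- A (noetherian local) ring is Gorenstein if it has finite injective dimension as a module over
itself. -/
def IsGorenstein : Prop :=
  injectiveDimension (ModuleCat.of R R) < ⊤

/-- The depth of a finitely generated module over a local ring: the supremum of the lengths of the
`M`-regular sequences in the maximal ideal. The condition `M ≠ (r₁, …, rₙ) M` is omitted: for
`M ≠ 0` it is automatic by Nakayama's lemma, and for `M = 0` the depth is then `∞`. -/
noncomputable def depth [IsLocalRing R] (M : Type u) [AddCommGroup M] [Module R M] : ℕ∞ :=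
  ⨆ rs : {rs : List R // (∀ r ∈ rs, r ∈ IsLocalRing.maximalIdeal R) ∧
    RingTheory.Sequence.IsWeaklyRegular M rs}, (rs.1.length : ℕ∞)

variable (R) in
/-- `CM R`: the maximal Cohen–Macaulay modules, that is, the finitely generated modules `M` with
`M = 0` or `depth M = dim R`. -/
def maximalCohenMacaulay [IsLocalRing R] : ObjectProperty (FGModuleCat.{u} R) :=
  fun M => Subsingleton M.obj ∨ (depth (R := R) M.obj : WithBot ℕ∞) = ringKrullDim R

end Modules

end ResolvingSubcat

open ResolvingSubcat

/-!
The starting point is that Condition (A) becomes an embedding property. The middle term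
`Y ∈ 𝒳 ∩ 𝒳^⊥` of a sequence `0 → X → Y → X' → 0` is maximal Cohen–Macaulay, so
`Ext^{>0}(Y, R) = 0` over the Gorenstein ring `R`, and `Ext^{>0}(Y, Y) = 0`; by the
Auslander–Reiten condition `Y` is free (`ConditionA.embedsInProjectives`).

**Gorenstein input.** Let `n` be the least bound with `Ext^{>n}(-, R) = 0` on finitely generated
modules; it exists because `R` has finite injective dimension. A prime filtration and Nakayama's
lemma show that `Ext^n(k, R) ≠ 0` for the residue field `k`
(`subsingleton_ext_of_residueField`), and this forces a regular sequence of length `n` in the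
maximal ideal (`exists_isRegular_of_nontrivial_ext`), so that `n ≤ dim R`. A weakly regular sequence
of length `n` on `M` then lowers the bound to `0` (`subsingleton_ext_of_isWeaklyRegular`).

**Syzygies.** For `0 → N → P → M → 0` with `P` projective and `M ∈ 𝒳^⊥`, the groups `Ext^i(X, N)`
vanish for `i ≥ 2` by the long exact sequence. For `i = 1`, the embedding `0 → X → F → X' → 0`
identifies `Ext^1(X, N)` with `Ext^2(X', N) = 0`.

**Coherence.** By the Yoneda lemma a presentation of `Hom(-, M)|_𝒳` yields an approximation.
Conversely, let `f : X → M` be an approximation and let `a : X' → X` satisfy `f a = 0`. Push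
`0 → X' → F → X'' → 0` out along `a` to `0 → X → W → X'' → 0`. Here `W ∈ 𝒳`, so the map
`(f, 0) : W → M` factors through `f`; this gives `φ : X → X` with `f φ = f` and `b : F → X` with
`f b = 0` such that `φ a` is the restriction of `b` to `X'`
(`IsRightApproximation.exists_comp_eq`). Hence `a = (1 - φ) a + b|_{X'}`. The module of the
`h : X → X` with `f h = 0` is finitely generated, say by `h₁, …, hₘ`, and `b` factors through a
surjection from a free module `G` to `ker f`, so every such `a` factors through the one map
`Xᵐ ⊕ G → X` given by the `hⱼ` and `G → ker f ⊆ X`. No minimal approximation enters the argument.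
-/

namespace ResolvingSubcat

/-! ### Approximations in an abelian category -/

section Approximation

variable {𝒜 : Type*} [Category 𝒜] [Abelian 𝒜]

/-- Every object of `𝒳` embeds into a projective object with cokernel in `𝒳`. -/
def EmbedsInProjectives (𝒳 : ObjectProperty 𝒜) : Prop :=
  ∀ X : 𝒜, 𝒳 X → ∃ (F X' : 𝒜) (i : X ⟶ F) (p : F ⟶ X') (w : i ≫ p = 0),
    (ShortComplex.mk i p w).ShortExact ∧ 𝒳 X' ∧ Projective F

/-- Pushing `0 ⟶ X₁ ⟶ X₂ ⟶ X₃ ⟶ 0` out along `a` gives an extension of `X₃` by the target of `a`. -/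
lemma shortExact_pushout {S : ShortComplex 𝒜} (hS : S.ShortExact) {X : 𝒜} (a : S.X₁ ⟶ X) :
    (ShortComplex.mk (pushout.inl a S.f)
      (pushout.desc (0 : X ⟶ S.X₃) S.g (by rw [comp_zero, S.zero]))
      (pushout.inl_desc _ _ _)).ShortExact := by
  have := hS.mono_f
  have := hS.epi_g
  let T := ShortComplex.mk (pushout.inl a S.f)
    (pushout.desc (0 : X ⟶ S.X₃) S.g (by rw [comp_zero, S.zero])) (pushout.inl_desc _ _ _)
  have hepi : Epi T.g := epi_of_epi_fac (pushout.inr_desc _ _ _)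
  have hmono : Mono T.f := inferInstanceAs (Mono (pushout.inl a S.f))
  refine { exact := T.exact_of_g_is_cokernel (CokernelCofork.IsColimit.ofπ' _ _ fun k hk => ?_) }
  have h : S.f ≫ pushout.inr a S.f ≫ k = 0 := by
    rw [← pushout.condition_assoc]
    exact (congrArg (a ≫ ·) hk).trans comp_zero
  refine ⟨hS.exact.desc _ h, pushout.hom_ext ?_ ?_⟩
  · rw [pushout.inl_desc_assoc, zero_comp]
    exact hk.symm
  · rw [pushout.inr_desc_assoc, hS.exact.g_desc]

variable {𝒳 : ObjectProperty 𝒜}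

lemma IsResolving.biprod (h𝒳 : IsResolving 𝒳) {A B : 𝒜} (hA : 𝒳 A) (hB : 𝒳 B) : 𝒳 (A ⊞ B) :=
  h𝒳.extension _ (ShortComplex.Splitting.ofHasBinaryBiproduct A B).shortExact hA hB

/-- A morphism killed by an approximation `f` agrees, up to an endomorphism of `X` over `M`, with a
morphism that extends along the monomorphism of the short exact sequence `S`. -/
lemma IsRightApproximation.exists_comp_eq (h𝒳 : IsResolving 𝒳) {X M : 𝒜} {f : X ⟶ M}
    (hf : IsRightApproximation 𝒳 f) {S : ShortComplex 𝒜} (hS : S.ShortExact) (h₃ : 𝒳 S.X₃)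
    (a : S.X₁ ⟶ X) (ha : a ≫ f = 0) :
    ∃ (φ : X ⟶ X) (b : S.X₂ ⟶ X), φ ≫ f = f ∧ b ≫ f = 0 ∧ a ≫ φ = S.f ≫ b := by
  -- The pushout of `a` and `S.f` lies in `𝒳`, so its morphism `(f, 0)` to `M` factors through `f`.
  obtain ⟨r, hr⟩ := hf.2 (pushout a S.f) (pushout.desc f 0 (by simp [ha]))
    (h𝒳.extension _ (shortExact_pushout hS a) hf.1 h₃)
  refine ⟨pushout.inl a S.f ≫ r, pushout.inr a S.f ≫ r, ?_, ?_, pushout.condition_assoc _⟩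
  · rw [Category.assoc, ← hr, pushout.inl_desc]
  · rw [Category.assoc, ← hr, pushout.inr_desc]

end Approximation

/-! ### Finitely presented functors -/

section FinitelyPresented

/-- Exactness in a functor category can be tested objectwise. -/
lemma exact_of_forall_evaluation {𝒞 𝒟 : Type*} [Category 𝒞] [Category 𝒟] [Abelian 𝒟]
    (S : ShortComplex (𝒞 ⥤ 𝒟)) (h : ∀ X : 𝒞, (S.map ((evaluation 𝒞 𝒟).obj X)).Exact) :
    S.Exact := by
  rw [ShortComplex.exact_iff_isZero_homology, Functor.isZero_iff]
  intro X
  exact ((ShortComplex.exact_iff_isZero_homology _).1 (h X)).of_iso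
    (S.mapHomologyIso ((evaluation 𝒞 𝒟).obj X)).symm

variable {𝒜 : Type*} [Category.{u} 𝒜] [Preadditive 𝒜] {𝒳 : ObjectProperty 𝒜}

lemma rap_of_finPres {M : 𝒜} (h : finPres 𝒳 M) : rap 𝒳 M := by
  obtain ⟨_, A₀, _, π, _, _, _⟩ := h
  refine ⟨A₀.obj, π.app (.op A₀) (𝟙 A₀), A₀.property, fun X' f' hX' => ?_⟩
  let A : 𝒳.FullSubcategory := ⟨X', hX'⟩
  have hsurj : Function.Surjective (π.app (.op A)) :=
    (AddCommGrpCat.epi_iff_surjective _).1 inferInstance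
  obtain ⟨g, hg⟩ := hsurj f'
  refine ⟨g.hom, ?_⟩
  have h := ConcreteCategory.congr_hom (π.naturality (Quiver.Hom.op g)) (𝟙 A₀)
  rw [← hg]
  refine Eq.trans ?_ h
  exact congrArg (π.app (.op A)) (Category.comp_id (g : A ⟶ A₀)).symm

/-- `Hom(-, M)|_𝒳` is finitely presented as soon as `M` has an approximation `f` and the morphisms
killed by `f` all factor through one morphism `g` killed by `f`. -/
lemma finPres_of_isRightApproximation {M X₀ X₁ : 𝒜} {f : X₀ ⟶ M}
    (hf : IsRightApproximation 𝒳 f) (h₁ : 𝒳 X₁) (g : X₁ ⟶ X₀) (hg : g ≫ f = 0)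
    (hfac : ∀ (X' : 𝒜) (a : X' ⟶ X₀), 𝒳 X' → a ≫ f = 0 → ∃ l : X' ⟶ X₁, a = l ≫ g) :
    finPres 𝒳 M := by
  let A₁ : 𝒳.FullSubcategory := ⟨X₁, h₁⟩
  let A₀ : 𝒳.FullSubcategory := ⟨X₀, hf.1⟩
  let g' : A₁ ⟶ A₀ := ObjectProperty.homMk g
  let π : preadditiveYoneda.obj A₀ ⟶ restrictedHom 𝒳 M :=
    { app := fun Z => AddCommGrpCat.ofHom
        { toFun := fun (x : Z.unop ⟶ A₀) => (x.hom ≫ f : Z.unop.obj ⟶ M)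
          map_zero' := zero_comp
          map_add' := fun _ _ => Preadditive.add_comp _ _ _ _ _ _ }
      naturality := fun Z Z' k => by
        ext x
        exact Category.assoc k.unop.hom (x : Z.unop ⟶ A₀).hom f }
  refine ⟨A₁, A₀, preadditiveYoneda.map g', π, ?_, exact_of_forall_evaluation _ fun Z => ?_, ?_⟩
  · ext Z x
    change ((x : Z.unop ⟶ A₁).hom ≫ g) ≫ f = 0
    rw [Category.assoc, hg, comp_zero]
  · rw [ShortComplex.ab_exact_iff]
    intro x hx
    obtain ⟨l, hl⟩ := hfac _ (x : Z.unop ⟶ A₀).hom Z.unop.property hx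
    exact ⟨(ObjectProperty.homMk l : Z.unop ⟶ A₁), ObjectProperty.hom_ext _ hl.symm⟩
  · have (Z : (𝒳.FullSubcategory)ᵒᵖ) : Epi (π.app Z) := by
      rw [AddCommGrpCat.epi_iff_surjective]
      intro x
      obtain ⟨l, hl⟩ := hf.2 _ (x : Z.unop.obj ⟶ M) Z.unop.property
      exact ⟨(ObjectProperty.homMk l : Z.unop ⟶ A₀), hl.symm⟩
    exact NatTrans.epi_of_epi_app _

end FinitelyPresented

/-! ### Finitely generated modules over a noetherian ring -/

section Noetherian

variable {R : Type u} [CommRing R] [IsNoetherianRing R]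

lemma shortExact_obj {S : ShortComplex (FGModuleCat.{u} R)} (hS : S.ShortExact) :
    (S.map (forget₂ (FGModuleCat.{u} R) (ModuleCat.{u} R))).ShortExact :=
  hS.map_of_exact _

lemma surjective_of_epi {X Y : FGModuleCat.{u} R} (f : X ⟶ Y) [Epi f] :
    Function.Surjective f.hom.hom :=
  (ModuleCat.epi_iff_surjective _).1
    (inferInstanceAs (Epi ((forget₂ (FGModuleCat.{u} R) (ModuleCat.{u} R)).map f)))

lemma projective_of_module_projective (P : FGModuleCat.{u} R) [Module.Projective R P.obj] :
    Projective P where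
  factors {E X} f e _ := by
    obtain ⟨h, hh⟩ := Module.projective_lifting_property e.hom.hom f.hom.hom (surjective_of_epi e)
    exact ⟨ObjectProperty.homMk (ModuleCat.ofHom h), FGModuleCat.hom_ext hh⟩

/-- Every finitely generated module is covered by a finitely generated free one. -/
lemma exists_free_epi (M : FGModuleCat.{u} R) :
    ∃ (F : FGModuleCat.{u} R) (p : F ⟶ M), Module.Free R F.obj ∧ Projective F ∧ Epi p := by
  obtain ⟨n, f, hf⟩ := Module.Finite.exists_fin' R M.obj
  let F : FGModuleCat.{u} R := FGModuleCat.of R (ULift.{u} (Fin n) → R)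
  let e : (ULift.{u} (Fin n) → R) ≃ₗ[R] (Fin n → R) := LinearEquiv.funCongrLeft R R Equiv.ulift.symm
  let p : F ⟶ M := ObjectProperty.homMk (ModuleCat.ofHom (f ∘ₗ e.toLinearMap))
  have hfree : Module.Free R F.obj := inferInstanceAs (Module.Free R (ULift.{u} (Fin n) → R))
  have hp : Epi ((forget₂ (FGModuleCat.{u} R) (ModuleCat.{u} R)).map p) :=
    (ModuleCat.epi_iff_surjective _).2 (hf.comp e.surjective)
  exact ⟨F, p, hfree, projective_of_module_projective F, Functor.epi_of_epi_map _ hp⟩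

lemma module_projective_of_projective (P : FGModuleCat.{u} R) [Projective P] :
    Module.Projective R P.obj := by
  obtain ⟨F, p, _, _, _⟩ := exists_free_epi P
  refine Module.Projective.of_split (Projective.factorThru (𝟙 P) p).hom.hom p.hom.hom ?_
  have h := Projective.factorThru_comp (𝟙 P) p
  exact congrArg (fun k => k.hom.hom) h

/-- For `f : X ⟶ M` with `X ∈ 𝒳`, the endomorphisms of `X` killed by `f` form a finitely generated
module, so they all factor through a single such morphism from an object of `𝒳`. -/
lemma exists_forall_endomorphism_factors {𝒳 : ObjectProperty (FGModuleCat.{u} R)}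
    (h𝒳 : IsResolving 𝒳) {X M : FGModuleCat.{u} R} (hX : 𝒳 X) (f : X ⟶ M) :
    ∃ (X₁ : FGModuleCat.{u} R) (g : X₁ ⟶ X), 𝒳 X₁ ∧ g ≫ f = 0 ∧
      ∀ h : X ⟶ X, h ≫ f = 0 → ∃ l : X ⟶ X₁, h = l ≫ g := by
  let mk : (X.obj →ₗ[R] X.obj) → (X ⟶ X) := fun h => ObjectProperty.homMk (ModuleCat.ofHom h)
  let K : Submodule R (X.obj →ₗ[R] X.obj) := LinearMap.ker (LinearMap.compRight R f.hom.hom)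
  have key : ∀ (N : Submodule R (X.obj →ₗ[R] X.obj)), N.FG → N ≤ K →
      ∃ (X₁ : FGModuleCat.{u} R) (g : X₁ ⟶ X), 𝒳 X₁ ∧ g ≫ f = 0 ∧
        ∀ h ∈ N, ∃ l : X ⟶ X₁, mk h = l ≫ g := by
    intro N hN
    induction N, hN using Submodule.fg_induction with
    | singleton x =>
      intro hx
      refine ⟨X, mk x, hX, FGModuleCat.hom_ext (hx (Submodule.mem_span_singleton_self x)), ?_⟩
      intro h hh
      obtain ⟨r, rfl⟩ := Submodule.mem_span_singleton.1 hh
      refine ⟨mk (r • LinearMap.id), FGModuleCat.hom_ext ?_⟩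
      ext y
      change r • x y = x (r • y)
      rw [map_smul]
    | sup N₁ N₂ _ _ ih₁ ih₂ =>
      intro hN
      obtain ⟨X₁, g₁, hX₁, hg₁, h₁⟩ := ih₁ (le_sup_left.trans hN)
      obtain ⟨X₂, g₂, hX₂, hg₂, h₂⟩ := ih₂ (le_sup_right.trans hN)
      refine ⟨X₁ ⊞ X₂, biprod.desc g₁ g₂, h𝒳.biprod hX₁ hX₂, ?_, ?_⟩
      · exact biprod.hom_ext' _ _ (by simp [hg₁]) (by simp [hg₂])
      · intro h hh
        obtain ⟨y, hy, z, hz, rfl⟩ := Submodule.mem_sup.1 hh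
        obtain ⟨l₁, hl₁⟩ := h₁ y hy
        obtain ⟨l₂, hl₂⟩ := h₂ z hz
        refine ⟨biprod.lift l₁ l₂, ?_⟩
        rw [biprod.lift_desc, ← hl₁, ← hl₂]
        rfl
  obtain ⟨X₁, g, hX₁, hg, h⟩ := key K (IsNoetherian.noetherian K) le_rfl
  exact ⟨X₁, g, hX₁, hg, fun k hk => h k.hom.hom <|
    LinearMap.mem_ker.2 (congrArg (fun k : X ⟶ M => k.hom.hom) hk)⟩

/-- If `f : X ⟶ M` is an approximation, a morphism `a : X' ⟶ X` killed by `f` is the sum of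
`a ≫ (𝟙 X - φ)`, with `φ ≫ f = f`, and a morphism that factors through an epimorphism from a fixed
free module to `ker f`. Hence all these `a` factor through a single morphism killed by `f`. -/
theorem EmbedsInProjectives.isCoherent {𝒳 : ObjectProperty (FGModuleCat.{u} R)}
    (hemb : EmbedsInProjectives 𝒳) (h𝒳 : IsResolving 𝒳) : IsCoherent 𝒳 := by
  refine le_antisymm (fun M => rap_of_finPres) fun M ⟨X, f, hf⟩ => ?_
  obtain ⟨X₁, g, hX₁, hg, hfac⟩ := exists_forall_endomorphism_factors h𝒳 hf.1 f
  obtain ⟨F, c, _, _, _⟩ := exists_free_epi (kernel f)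
  refine finPres_of_isRightApproximation hf (h𝒳.biprod hX₁ (h𝒳.projective F inferInstance))
    (biprod.desc g (c ≫ kernel.ι f)) (biprod.hom_ext' _ _ (by simp [hg]) (by simp))
    fun X' a hX' ha => ?_
  obtain ⟨F', X'', i, p, w, hS, hX'', hF'⟩ := hemb X' hX'
  obtain ⟨φ, b, hφ, hb, hab⟩ := hf.exists_comp_eq h𝒳 hS hX'' a ha
  obtain ⟨l, hl⟩ := hfac (𝟙 X - φ) (by simp [hφ])
  -- `a = a ≫ (𝟙 - φ) + i ≫ b`, and both summands factor as required.
  let b' := Projective.factorThru (kernel.lift f b hb) c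
  have hb' : b' ≫ c ≫ kernel.ι f = b := by simp [b']
  refine ⟨biprod.lift (a ≫ l) (i ≫ b'), ?_⟩
  dsimp at hab
  rw [biprod.lift_desc, Category.assoc, Category.assoc, ← hl, hb', ← hab]
  simp

end Noetherian

/-! ### Vanishing of Ext over a Gorenstein local ring -/

section Ext

variable {R : Type u} [CommRing R]

/-- `Ext^i(S.X₂, N)` vanishes if `Ext^i(S.X₁, N)` and `Ext^i(S.X₃, N)` do. -/
lemma subsingleton_ext_X₂ {S : ShortComplex (ModuleCat.{u} R)} (hS : S.ShortExact)
    {N : ModuleCat.{u} R} {i : ℕ} (h₁ : Subsingleton (Ext.{u} S.X₁ N i))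
    (h₃ : Subsingleton (Ext.{u} S.X₃ N i)) : Subsingleton (Ext.{u} S.X₂ N i) := by
  refine subsingleton_of_forall_eq 0 fun x => ?_
  obtain ⟨y, rfl⟩ := Ext.contravariant_sequence_exact₂ hS N x (Subsingleton.elim _ _)
  rw [Subsingleton.elim y 0, Ext.comp_zero]

lemma subsingleton_ext_of_linearEquiv {M M' N : ModuleCat.{u} R} (e : M ≃ₗ[R] M') {i : ℕ}
    (h : Subsingleton (Ext.{u} M N i)) : Subsingleton (Ext.{u} M' N i) := by
  refine subsingleton_of_forall_eq 0 fun x => ?_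
  have hx : x = (Ext.mk₀ e.toModuleIso.inv).comp
      ((Ext.mk₀ e.toModuleIso.hom).comp x (zero_add i)) (zero_add i) := by
    rw [Ext.mk₀_comp_mk₀_assoc, e.toModuleIso.inv_hom_id, Ext.mk₀_id_comp]
  rw [hx, Subsingleton.elim ((Ext.mk₀ e.toModuleIso.hom).comp x (zero_add i)) 0, Ext.comp_zero]

lemma ExtPosVanish.prod {M N N' : ModuleCat.{u} R} (h : ExtPosVanish M N)
    (h' : ExtPosVanish M N') : ExtPosVanish M (ModuleCat.of R (N × N')) := by
  intro i hi
  have := h i hi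
  have := h' i hi
  refine subsingleton_of_forall_eq 0 fun x => ?_
  have hid : 𝟙 (ModuleCat.of R (N × N')) =
      ModuleCat.ofHom (LinearMap.fst R N N') ≫ ModuleCat.ofHom (LinearMap.inl R N N') +
        ModuleCat.ofHom (LinearMap.snd R N N') ≫ ModuleCat.ofHom (LinearMap.inr R N N') := by
    ext x <;> simp
  rw [← Ext.comp_mk₀_id x, hid, Ext.mk₀_add, Ext.comp_add, ← Ext.mk₀_comp_mk₀, ← Ext.mk₀_comp_mk₀,
    ← Ext.comp_assoc_of_second_deg_zero, ← Ext.comp_assoc_of_second_deg_zero,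
    Subsingleton.elim (x.comp (Ext.mk₀ (ModuleCat.ofHom (LinearMap.fst R N N'))) (add_zero i)) 0,
    Subsingleton.elim (x.comp (Ext.mk₀ (ModuleCat.ofHom (LinearMap.snd R N N'))) (add_zero i)) 0]
  simp

/-- The identity of a finitely generated free module `P` is a sum of endomorphisms that factor
through `R`, so `Ext(M, P)` vanishes with `Ext(M, R)`. -/
lemma ExtPosVanish.of_free {M : ModuleCat.{u} R} (h : ExtPosVanish M (ModuleCat.of R R))
    (P : ModuleCat.{u} R) [Module.Finite R P] [Module.Free R P] : ExtPosVanish M P := by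
  intro i hi
  have := h i hi
  refine subsingleton_of_forall_eq 0 fun x => ?_
  let b := Module.Free.chooseBasis R P
  have hid : 𝟙 P = ∑ j, (ModuleCat.ofHom (b.coord j) : P ⟶ ModuleCat.of R R) ≫
      ModuleCat.ofHom (LinearMap.toSpanSingleton R P (b j)) := by
    ext y
    simp [ModuleCat.hom_sum, b.sum_repr]
  rw [← Ext.comp_mk₀_id x, hid, Ext.mk₀_sum, Ext.comp_sum]
  refine Finset.sum_eq_zero fun j _ => ?_
  rw [← Ext.mk₀_comp_mk₀, ← Ext.comp_assoc_of_second_deg_zero,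
    Subsingleton.elim (x.comp (Ext.mk₀ (ModuleCat.ofHom (b.coord j))) (add_zero i)) 0,
    Ext.zero_comp]

end Ext

section Local

variable {R : Type u} [CommRing R] [IsNoetherianRing R] [IsLocalRing R]

/-- If `x` in the maximal ideal is `M`-regular and `Ext^{i+1}(M/xM, N) = 0`, then multiplication by
`x` is surjective on `Ext^i(M, N)`, which vanishes by Nakayama's lemma. -/
lemma subsingleton_ext_of_quotSMulTop {M N : ModuleCat.{u} R} [Module.Finite R M]
    [Module.Finite R N] {x : R} (hx : x ∈ IsLocalRing.maximalIdeal R) (hreg : IsSMulRegular M x)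
    {i : ℕ} (h : Subsingleton (Ext.{u} (ModuleCat.of R (QuotSMulTop x M)) N (i + 1))) :
    Subsingleton (Ext.{u} M N i) := by
  by_contra! hnt
  have hmem : x ∈ (Module.annihilator R (Ext.{u} M N i)).jacobson :=
    IsLocalRing.maximalIdeal_le_jacobson _ hx
  refine Submodule.top_ne_pointwise_smul_of_mem_jacobson_annihilator hmem ?_
  refine (eq_top_iff.2 fun y _ => ?_).symm
  obtain ⟨z, hz⟩ := Ext.contravariant_sequence_exact₁ hreg.smulShortComplex_shortExact N y
    (add_comm 1 i) (h.elim _ _)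
  let z' : Ext.{u} M N i := z
  have hz' : (Ext.mk₀ (x • 𝟙 M)).comp z' (zero_add i) = x • z' := by
    rw [Ext.mk₀_smul, Ext.smul_comp, Ext.mk₀_id_comp]
  rw [show y = x • z' from hz.symm.trans hz']
  exact Submodule.smul_mem_pointwise_smul _ _ ⊤ trivial

/-- A weakly regular sequence of length `r` on `M` lowers the bound `n` on the degrees of the
nonzero `Ext(M, N)` by `r`. -/
lemma subsingleton_ext_of_isWeaklyRegular {N : ModuleCat.{u} R} [Module.Finite R N] {n : ℕ}
    (hn : ∀ (M : ModuleCat.{u} R) [Module.Finite R M] (i : ℕ), n < i →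
      Subsingleton (Ext.{u} M N i))
    (rs : List R) (hrs : ∀ r ∈ rs, r ∈ IsLocalRing.maximalIdeal R) (M : ModuleCat.{u} R)
    [Module.Finite R M] (hreg : RingTheory.Sequence.IsWeaklyRegular M rs) (i : ℕ)
    (hi : n < i + rs.length) : Subsingleton (Ext.{u} M N i) := by
  induction rs generalizing M i with
  | nil => exact hn M i hi
  | cons r rs ih =>
    rw [RingTheory.Sequence.isWeaklyRegular_cons_iff] at hreg
    refine subsingleton_ext_of_quotSMulTop (hrs r List.mem_cons_self) hreg.1 ?_
    exact ih (fun s hs => hrs s (List.mem_cons_of_mem _ hs)) (ModuleCat.of R (QuotSMulTop r M))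
      hreg.2 _ (by simpa [add_assoc, add_comm 1] using hi)

/-- If `Ext^{n+1}(-, N)` and `Ext^n(k, N)` vanish for the residue field `k`, so does `Ext^n(-, N)`:
a finitely generated module has a filtration with quotients `R ⧸ p`, and for `p` not maximal some
element of the maximal ideal is regular on `R ⧸ p`. -/
lemma subsingleton_ext_of_residueField {N : ModuleCat.{u} R} [Module.Finite R N] {n : ℕ}
    (hn : ∀ (M : ModuleCat.{u} R) [Module.Finite R M], Subsingleton (Ext.{u} M N (n + 1)))
    (hk : Subsingleton (Ext.{u} (ModuleCat.of R (IsLocalRing.ResidueField R)) N n))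
    (M : ModuleCat.{u} R) [hM : Module.Finite R M] : Subsingleton (Ext.{u} M N n) := by
  suffices ∀ (M : Type u) [AddCommGroup M] [Module R M] (_ : Module.Finite R M),
      Subsingleton (Ext.{u} (ModuleCat.of R M) N n) from this M hM
  intro M _ _ hM
  induction hM using IsNoetherianRing.induction_on_isQuotientEquivQuotientPrime with
  | subsingleton M =>
    have hz : IsZero (ModuleCat.of R M) := ModuleCat.isZero_of_subsingleton _
    refine subsingleton_of_forall_eq 0 fun x => ?_
    rw [← Ext.mk₀_id_comp x, hz.eq_of_src (𝟙 _) 0, Ext.mk₀_zero, Ext.zero_comp]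
  | quotient M p e =>
    refine subsingleton_ext_of_linearEquiv (M := ModuleCat.of R (R ⧸ p.1)) e.symm ?_
    by_cases hp : p.1 = IsLocalRing.maximalIdeal R
    · rw [hp]
      exact hk
    · obtain ⟨x, hx, hxp⟩ := SetLike.exists_of_lt
        (lt_of_le_of_ne (IsLocalRing.le_maximalIdeal p.2.ne_top) hp)
      refine subsingleton_ext_of_quotSMulTop hx ?_ (hn _)
      intro a b hab
      have : p.1.IsPrime := p.2
      have hx0 : (Ideal.Quotient.mk p.1 x) ≠ 0 := fun h0 =>
        hxp (Ideal.Quotient.eq_zero_iff_mem.1 h0)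
      exact mul_left_cancel₀ hx0 hab
  | exact N₁ N₂ N₃ f g hf hg hfg h₁ h₃ =>
    exact subsingleton_ext_X₂ (S := ModuleCat.shortComplexOfCompEqZero f g
        hfg.linearMap_comp_eq_zero)
      { exact := ModuleCat.shortComplex_exact _ hfg
        mono_f := (ModuleCat.mono_iff_injective _).2 hf
        epi_g := (ModuleCat.epi_iff_surjective _).2 hg } h₁ h₃

/-- If `Ext^{n+1}(-, N) = 0` and `Ext^n(k, N) ≠ 0`, there is a regular sequence of length `n` in the
maximal ideal: a regular sequence `rs` of smaller length extends, since otherwise `k` embeds in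
`R ⧸ (rs)`, and `Ext^n(k, N)` is a quotient of `Ext^n(R ⧸ (rs), N)`, which vanishes as `R ⧸ (rs)`
has projective dimension less than `n`. -/
lemma exists_isRegular_of_nontrivial_ext {N : ModuleCat.{u} R} {n : ℕ}
    (hn : ∀ (M : ModuleCat.{u} R) [Module.Finite R M], Subsingleton (Ext.{u} M N (n + 1)))
    (hk : Nontrivial (Ext.{u} (ModuleCat.of R (IsLocalRing.ResidueField R)) N n)) :
    ∀ m ≤ n, ∃ rs : List R, rs.length = m ∧ (∀ r ∈ rs, r ∈ IsLocalRing.maximalIdeal R) ∧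
      RingTheory.Sequence.IsWeaklyRegular R rs := by
  intro m
  induction m with
  | zero => exact fun _ => ⟨[], rfl, by simp, .nil R R⟩
  | succ m ih =>
    intro hm
    obtain ⟨rs, hlen, hmem, hreg⟩ := ih (by lia)
    let Q := R ⧸ (Ideal.ofList rs • ⊤ : Submodule R R)
    by_cases hQ : ∃ x ∈ IsLocalRing.maximalIdeal R, IsSMulRegular Q x
    · obtain ⟨x, hx, hxreg⟩ := hQ
      refine ⟨rs ++ [x], by simp [hlen], ?_, ?_⟩
      · intro r hr
        rcases List.mem_append.1 hr with hr | hr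
        · exact hmem r hr
        · rwa [List.mem_singleton.1 hr]
      · rw [RingTheory.Sequence.isWeaklyRegular_append_iff,
          RingTheory.Sequence.isWeaklyRegular_singleton_iff]
        exact ⟨hreg, hxreg⟩
    · exfalso
      have hann : Module.annihilator R (IsLocalRing.ResidueField R) = IsLocalRing.maximalIdeal R :=
        Ideal.annihilator_quotient
      rw [← hann, ← IsSMulRegular.subsingleton_linearMap_iff, not_subsingleton_iff_nontrivial] at hQ
      obtain ⟨f, hf⟩ := exists_ne (0 : IsLocalRing.ResidueField R →ₗ[R] Q)
      have hsimple : IsSimpleModule R (IsLocalRing.ResidueField R) :=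
        isSimpleModule_iff_quot_maximal.2 ⟨_, inferInstance, ⟨LinearEquiv.refl R _⟩⟩
      have hinj : Function.Injective f := (LinearMap.injective_or_eq_zero f).resolve_right hf
      let S := ModuleCat.shortComplexOfCompEqZero f (LinearMap.range f).mkQ
        (LinearMap.range_mkQ_comp f)
      have hS : S.ShortExact :=
        { exact := ModuleCat.shortComplex_exact _ (LinearMap.exact_map_mkQ_range f)
          mono_f := (ModuleCat.mono_iff_injective _).2 hinj
          epi_g := (ModuleCat.epi_iff_surjective _).2 (Submodule.mkQ_surjective _) }
      have hpd : projectiveDimension (ModuleCat.of R Q) < (n : ℕ) := by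
        rw [ModuleCat.projectiveDimension_quotient_eq_add_length_of_isWeaklyRegular
          (ModuleCat.of R R) rs hreg hmem,
          ModuleCat.projectiveDimension_eq_zero_of_projective, zero_add, hlen]
        exact_mod_cast hm
      rw [projectiveDimension_lt_iff] at hpd
      refine not_subsingleton_iff_nontrivial.2 hk (subsingleton_of_forall_eq 0 fun x => ?_)
      obtain ⟨y, rfl⟩ := Ext.contravariant_sequence_exact₁ hS N x (add_comm 1 n)
        ((hn (ModuleCat.of R (Q ⧸ LinearMap.range f))).elim _ _)
      have hy : y = 0 := Ext.eq_zero_of_hasProjectiveDimensionLT (X := ModuleCat.of R Q) y n le_rfl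
      rw [hy, Ext.comp_zero]

/-- Over a Gorenstein local ring, `Ext^i(-, R)` vanishes on finitely generated modules for
`i > dim R`. -/
lemma IsGorenstein.exists_bound (hGor : IsGorenstein R) :
    ∃ n : ℕ, (n : WithBot ℕ∞) ≤ ringKrullDim R ∧ ∀ (M : ModuleCat.{u} R) [Module.Finite R M]
      (i : ℕ), n < i → Subsingleton (Ext.{u} M (ModuleCat.of R R) i) := by
  classical
  have hex : ∃ n : ℕ, ∀ (M : ModuleCat.{u} R) [Module.Finite R M] (i : ℕ), n < i →
      Subsingleton (Ext.{u} M (ModuleCat.of R R) i) := by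
    obtain ⟨n, hn⟩ := (injectiveDimension_ne_top_iff _).1 hGor.ne
    exact ⟨n, fun M _ i hi => HasInjectiveDimensionLT.subsingleton _ (n + 1) i hi M⟩
  -- The least bound is at most `dim R`, because it is the length of a regular sequence.
  refine ⟨Nat.find hex, ?_, Nat.find_spec hex⟩
  have hmin := fun m => Nat.find_min hex (m := m)
  have hspec := Nat.find_spec hex
  generalize Nat.find hex = n at hmin hspec
  rcases n with _ | n
  · exact_mod_cast ringKrullDim_nonneg_of_nontrivial
  have hk : Nontrivial (Ext.{u} (ModuleCat.of R (IsLocalRing.ResidueField R))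
      (ModuleCat.of R R) (n + 1)) := by
    by_contra! hk
    refine hmin n (by lia) fun M _ i hi => ?_
    rcases (show n + 1 ≤ i from hi).eq_or_lt with rfl | hi
    · exact subsingleton_ext_of_residueField (fun M _ => hspec M _ (by lia)) hk M
    · exact hspec M i hi
  obtain ⟨rs, hlen, hmem, hreg⟩ :=
    exists_isRegular_of_nontrivial_ext (fun M _ => hspec M _ (by lia)) hk _ le_rfl
  have hreg' := RingTheory.Sequence.IsRegular.of_isWeaklyRegular_of_mem_maximalIdeal R hmem hreg
  have : Nontrivial (R ⧸ Ideal.ofList rs) := by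
    have := hreg'.quot_ofList_smul_nontrivial ⊤
    simpa using this
  rw [← ringKrullDim_add_length_eq_ringKrullDim_of_isRegular rs hreg', hlen]
  exact le_add_of_nonneg_left ringKrullDim_nonneg_of_nontrivial

/-- Over a Gorenstein local ring, a maximal Cohen–Macaulay module `M` satisfies
`Ext^{>0}(M, P) = 0` for all finitely generated free modules `P`. -/
lemma extPosVanish_of_maximalCohenMacaulay (hGor : IsGorenstein R) {M : FGModuleCat.{u} R}
    (hM : maximalCohenMacaulay R M) (P : ModuleCat.{u} R) [Module.Finite R P] [Module.Free R P] :
    ExtPosVanish M.obj P := by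
  refine ExtPosVanish.of_free (fun i hi => ?_) P
  have hfin : Module.Finite R M.obj := M.property
  rcases hM with hM | hM
  · refine subsingleton_of_forall_eq 0 fun x => ?_
    rw [← Ext.mk₀_id_comp x, (ModuleCat.isZero_of_subsingleton M.obj).eq_of_src (𝟙 _) 0,
      Ext.mk₀_zero, Ext.zero_comp]
  obtain ⟨n, hn, hvan⟩ := hGor.exists_bound
  obtain ⟨rs, hmem, hreg, hlen⟩ : ∃ rs : List R, (∀ r ∈ rs, r ∈ IsLocalRing.maximalIdeal R) ∧
      RingTheory.Sequence.IsWeaklyRegular M.obj rs ∧ n ≤ rs.length := by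
    rcases n with _ | n
    · exact ⟨[], by simp, .nil R _, Nat.zero_le _⟩
    · have hlt : (n : ℕ∞) < depth (R := R) M.obj := by
        rw [← hM] at hn
        have hn' : ((n + 1 : ℕ) : ℕ∞) ≤ depth (R := R) M.obj := by exact_mod_cast hn
        exact lt_of_lt_of_le (by exact_mod_cast n.lt_succ_self) hn'
      obtain ⟨rs, hrs⟩ := lt_iSup_iff.1 hlt
      exact ⟨rs.1, rs.2.1, rs.2.2, by exact_mod_cast hrs⟩
  exact subsingleton_ext_of_isWeaklyRegular hvan rs hmem M.obj hreg i (by lia)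

end Local

/-! ### Condition (A) over a Gorenstein ring with the Auslander–Reiten condition -/

section ConditionA

variable {R : Type u} [CommRing R] [IsNoetherianRing R]

/-- If `N` is `Ext^{≥ 2}`-orthogonal to `𝒳` and every `X ∈ 𝒳` embeds into a projective object with
cokernel `X' ∈ 𝒳`, then `Ext^1(X, N)` is a quotient of `Ext^1(F, N) = 0`, because it maps to
`Ext^2(X', N) = 0`. -/
lemma perp_of_two_le {𝒳 : ObjectProperty (FGModuleCat.{u} R)}
    (hemb : EmbedsInProjectives 𝒳)
    {N : FGModuleCat.{u} R} (hN : ∀ X, 𝒳 X → ∀ i ≥ 2, Subsingleton (Ext.{u} X.obj N.obj i)) :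
    perp 𝒳 N := by
  intro X hX i hi
  rcases (show 1 ≤ i from hi).eq_or_lt with rfl | hi
  · obtain ⟨F, X', j, p, w, hS, hX', hF⟩ := hemb X hX
    have := module_projective_of_projective F
    have hproj : Projective F.obj := (IsProjective.iff_projective F.obj).1 this
    refine subsingleton_of_forall_eq 0 fun x => ?_
    obtain ⟨y, rfl⟩ := Ext.contravariant_sequence_exact₁ (shortExact_obj hS) N.obj x
      (n₁ := 2) rfl ((hN X' hX' 2 le_rfl).elim _ _)
    have hy : y = 0 := Ext.eq_zero_of_projective (P := F.obj) y
    rw [hy, Ext.comp_zero]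
    rfl
  · exact hN X hX i hi

variable [IsLocalRing R] {𝒳 : ObjectProperty (FGModuleCat.{u} R)}

/-- The middle term `Y ∈ 𝒳 ∩ 𝒳^⊥` of a sequence as in Condition (A) satisfies
`Ext^{>0}(Y, Y ⊕ R) = 0`, so it is free. -/
lemma ConditionA.embedsInProjectives (hGor : IsGorenstein R) (hARC : ARC R)
    (hCM : 𝒳 ≤ maximalCohenMacaulay R) (hA : ConditionA 𝒳) : EmbedsInProjectives 𝒳 := by
  intro X hX
  obtain ⟨Y, X', i, p, w, hS, hX', hY, hperp⟩ := hA X hX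
  have hfree : Module.Free R Y.obj := hARC Y <| (hperp Y hY).prod <|
    extPosVanish_of_maximalCohenMacaulay hGor (hCM Y hY) (ModuleCat.of R R)
  exact ⟨Y, X', i, p, w, hS, hX', projective_of_module_projective Y⟩

lemma perp_of_projective (hGor : IsGorenstein R) (hCM : 𝒳 ≤ maximalCohenMacaulay R)
    (P : FGModuleCat.{u} R) [Projective P] : perp 𝒳 P := by
  intro X hX
  have hfin : Module.Finite R P.obj := P.property
  have hproj := module_projective_of_projective P
  have hfree : Module.Free R P.obj := Module.free_of_flat_of_isLocalRing
  exact extPosVanish_of_maximalCohenMacaulay hGor (hCM X hX) P.obj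

/-- Given `0 ⟶ N ⟶ P ⟶ M ⟶ 0` with `M, P ∈ 𝒳^⊥`, the long exact sequence gives
`Ext^{≥ 2}(𝒳, N) = 0`, which suffices by `perp_of_two_le`. -/
lemma isClosedUnderSyzygies_perp (hGor : IsGorenstein R) (hCM : 𝒳 ≤ maximalCohenMacaulay R)
    (hemb : EmbedsInProjectives 𝒳) :
    IsClosedUnderSyzygies (perp 𝒳) where
  projective P _ := perp_of_projective hGor hCM P
  syzygy S hS _ h₃ := by
    refine perp_of_two_le hemb fun X hX i hi => subsingleton_of_forall_eq 0 fun x => ?_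
    obtain ⟨i, rfl⟩ : ∃ k, i = k + 1 := ⟨i - 1, by lia⟩
    obtain ⟨y, rfl⟩ := Ext.covariant_sequence_exact₁ X.obj (shortExact_obj hS) x
      ((perp_of_projective hGor hCM S.X₂ X hX (i + 1) (by lia)).elim _ _) rfl
    have hy : y = 0 := (h₃ X hX i (by lia)).elim _ _
    rw [hy, Ext.zero_comp]
    rfl

end ConditionA

end ResolvingSubcat

theorem mainTheorem6 {R : Type u} [CommRing R] [IsNoetherianRing R] [HenselianLocalRing R]
    (hGor : IsGorenstein R) (hARC : ARC R)
    (𝒳 : ObjectProperty (FGModuleCat.{u} R)) (hres : IsResolving 𝒳)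
    (hCM : 𝒳 ≤ maximalCohenMacaulay R) (hA : ConditionA 𝒳) :
    IsCoherent 𝒳 ∧ IsClosedUnderSyzygies (perp 𝒳) := by
  have hemb := hA.embedsInProjectives hGor hARC hCM
  exact ⟨hemb.isCoherent hres,
    isClosedUnderSyzygies_perp hGor hCM hemb⟩
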